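/- For real $x>0$, $y>0$ and $2(2-e^x)\le z<2$ put $$\hat x(x,z)=x+\min\bigl\{\max\{0,\ln(2e^x-2)\},\ \ln(2e^x-2)-\ln(2-z)\bigr\},\qquad \hat y(y,z)=y+\max\{0,\ln|-2+ze^y|\}$$ (with the convention $\max\{0,\ln 0\}=0$). Then the supremum $$\sup\Bigl\{\frac{\hat x(x,z)+\hat y(y,z)}{2e^x-x-2+\int_0^y|-1+ze^s|\,ds}\;:\; x>0,\ y>0,\ 2(2-e^x)\le z<2\Bigr\}$$ is finite and is equal to $$\sup\Bigl\{\frac{x+y}{2e^x-x-4-y+2(2-e^x)(e^y+1)-2\ln(2(2-e^x))}\Bigr\},$$ where the latter supremum is taken over all real $x,y$ with $x\in[\ln(3/2),\ln 2)$ and $e^{-y}\le 2(2-e^x)\le 3e^{-y}$. Moreover, the latter supremum is attained at a point $(x,y)$ of this region which lies on the curve $e^x=2(2-e^x)e^y$, $x\in[\ln(3/2),\ln 2)$. -/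

import Mathlib

/-- The quantity `x̂(x, z) = x + (0 ∨ ln(2eˣ - 2)) ∧ (ln(2eˣ - 2) - ln(2 - z))`.
It is used for `x > 0` and `z < 2`, where both logarithms have positive arguments. -/
noncomputable def xHat (x z : ℝ) : ℝ :=
  x + min (max 0 (Real.log (2 * Real.exp x - 2)))
    (Real.log (2 * Real.exp x - 2) - Real.log (2 - z))

/-- The quantity `ŷ(y, z) = y + 0 ∨ ln|-2 + z eʸ|`. When `z eʸ = 2` the usual convention
`0 ∨ ln 0 = 0 ∨ (-∞) = 0` agrees with `Real.log 0 = 0`. -/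
noncomputable def yHat (y z : ℝ) : ℝ :=
  y + max 0 (Real.log |-2 + z * Real.exp y|)

/-- The denominator `2eˣ - x - 2 + ∫₀ʸ |-1 + z eˢ| ds` of the three-parameter family. -/
noncomputable def fullDenominator (x y z : ℝ) : ℝ :=
  2 * Real.exp x - x - 2 + ∫ s in (0 : ℝ)..y, |-1 + z * Real.exp s|

/-- The lower bound provided by the parameters `(x, y, z)`. -/
noncomputable def fullQuotient (x y z : ℝ) : ℝ :=
  (xHat x z + yHat y z) / fullDenominator x y z

/-- The lower bounds provided by the full family: `x > 0`, `y > 0`, `2(2 - eˣ) ≤ z < 2`. -/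
def fullValues : Set ℝ :=
  {r | ∃ x y z : ℝ, 0 < x ∧ 0 < y ∧ 2 * (2 - Real.exp x) ≤ z ∧ z < 2 ∧
    r = fullQuotient x y z}

/-- The explicit lower bound for the special choice `z = 2(2 - eˣ)`. -/
noncomputable def specialQuotient (x y : ℝ) : ℝ :=
  (x + y) /
    (2 * Real.exp x - x - 4 - y + 2 * (2 - Real.exp x) * (Real.exp y + 1)
      - 2 * Real.log (2 * (2 - Real.exp x)))

/-- The restricted region: `x ∈ [ln(3/2), ln 2)` and `e⁻ʸ ≤ 2(2 - eˣ) ≤ 3e⁻ʸ`. -/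
def specialRegion : Set (ℝ × ℝ) :=
  {p | p.1 ∈ Set.Ico (Real.log (3 / 2)) (Real.log 2) ∧
    Real.exp (-p.2) ≤ 2 * (2 - Real.exp p.1) ∧
    2 * (2 - Real.exp p.1) ≤ 3 * Real.exp (-p.2)}

/-- The lower bounds provided by the restricted family. -/
def specialValues : Set ℝ :=
  {r | ∃ x y : ℝ, (x, y) ∈ specialRegion ∧ r = specialQuotient x y}

open Real

/-! The supremum is `1 / k`, with `k` the root in `IsOptimalRate`. The upper bound is the linear
inequality `rate_mul_le_fullDenominator`. For fixed `z` it splits into an `x`-part and the `y`-gain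
`k * yHat - ∫`, coupled only through `log (2 - z)` in `xHat`. Each part is bounded by tangent lines
of `log`. In the critical case `0 < z ≤ 1`, `large_x_bound` is tight at `eˣ = 1 + k`, the crossing
bound of `yGain_of_le_one` at `z eʸ = 1 + k`, and `rate_le_profile` at `z = 2(1 - k)`; the root
equation makes the constants cancel. These equalities hold together at a point with `z = 2(2 - eˣ)`,
so the restricted family already attains the bound. -/

lemma log_le_tangent {c t : ℝ} (hc : 0 < c) (ht : 0 < t) : log t ≤ t / c - 1 + log c := by
  have := log_le_sub_one_of_pos (div_pos ht hc)
  rw [log_div ht.ne' hc.ne'] at this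
  linarith

/-! ### The optimal rate -/

/-- The root equation determining the maximiser; the optimal value is `1 / k`. -/
structure IsOptimalRate (k : ℝ) : Prop where
  lower : 0.725 ≤ k
  upper : k ≤ 0.735
  root : 2 * (1 + k) * log (1 + k) + (1 - k) * log (2 * (1 - k)) = 1 + k

lemma log_div_bounds {x : ℝ} (h₀ : 0 ≤ x) (h : x < 1) (n : ℕ) :
    2 * ∑ i ∈ Finset.range n, x ^ (2 * i + 1) / (2 * i + 1) ≤ log ((1 + x) / (1 - x)) ∧
      log ((1 + x) / (1 - x)) ≤
        2 * (∑ i ∈ Finset.range n, x ^ (2 * i + 1) / (2 * i + 1) +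
          x ^ (2 * n + 1) / (1 - x ^ 2)) := by
  have h1 := sum_range_le_log_div h₀ h n
  have h2 := log_div_le_sum_range_add h₀ h n
  constructor <;> linarith

lemma exists_isOptimalRate : ∃ k, IsOptimalRate k := by
  have hc : ContinuousOn (fun k : ℝ => 2 * (1 + k) * log (1 + k) +
      (1 - k) * log (2 * (1 - k)) - (1 + k)) (Set.Icc 0.725 0.735) := by
    refine ContinuousOn.sub (ContinuousOn.add ?_ ?_) (by fun_prop)
    · exact ContinuousOn.mul (by fun_prop) (ContinuousOn.log (by fun_prop)
        (fun k hk => by linarith [hk.1] : ∀ k ∈ Set.Icc (0.725 : ℝ) 0.735, 1 + k ≠ 0))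
    · refine ContinuousOn.mul (by fun_prop) (ContinuousOn.log (by fun_prop) ?_)
      intro k hk
      have := hk.2
      norm_num at this
      linarith
  -- The four arguments give `(1 + x) / (1 - x)` equal to 1.725, 1/0.55, 1.735 and 1/0.53: the
  -- values of `1 + k` and `1 / (2 * (1 - k))` at the two ends.
  have a1 := (log_div_bounds (x := 29 / 109) (by norm_num) (by norm_num) 4).2
  have a2 := (log_div_bounds (x := 9 / 31) (by norm_num) (by norm_num) 4).1
  have b1 := (log_div_bounds (x := 147 / 547) (by norm_num) (by norm_num) 4).1
  have b2 := (log_div_bounds (x := 47 / 153) (by norm_num) (by norm_num) 4).2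
  norm_num [Finset.sum_range_succ] at a1 a2 b1 b2
  have e1 : log (11 / 20 : ℝ) = -log (20 / 11) := by rw [← log_inv]; norm_num
  have e2 : log (53 / 100 : ℝ) = -log (100 / 53) := by rw [← log_inv]; norm_num
  obtain ⟨k, hk, h⟩ := intermediate_value_Icc (by norm_num) hc
    (show (0 : ℝ) ∈ _ by constructor <;> norm_num [e1, e2] <;> linarith)
  exact ⟨k, hk.1, hk.2, by simpa [sub_eq_zero] using h⟩

/-! ### Monotonicity of the profile -/

/-- Up to constants, `logProfile` is the gain in `ŷ` against the cost while `z eʸ ≤ 1`. -/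
noncomputable def logProfile (k w : ℝ) : ℝ := -(1 - k) * log w + k * log (2 - w) + w

lemma hasDerivAt_logProfile (k : ℝ) {w : ℝ} (h0 : 0 < w) (h2 : w < 2) :
    HasDerivAt (logProfile k) ((1 - w) * (w - 2 * (1 - k)) / (w * (2 - w))) w := by
  have h2' : 2 - w ≠ 0 := by linarith
  have := (((hasDerivAt_log h0.ne').const_mul (-(1 - k))).add
    ((((hasDerivAt_id w).const_sub 2).log h2').const_mul k)).add (hasDerivAt_id w)
  refine HasDerivAt.congr_deriv (f := logProfile k) this ?_
  simp only [id]
  field_simp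
  ring

lemma continuousOn_logProfile (k : ℝ) {s : Set ℝ} (hs : ∀ w ∈ s, 0 < w ∧ w < 2) :
    ContinuousOn (logProfile k) s := fun w hw =>
  (hasDerivAt_logProfile k (hs w hw).1 (hs w hw).2).continuousAt.continuousWithinAt

lemma antitoneOn_logProfile {k : ℝ} (hk : IsOptimalRate k) :
    AntitoneOn (logProfile k) (Set.Ioc 0 (2 * (1 - k))) := by
  have hl := hk.lower
  norm_num at hl
  refine antitoneOn_of_deriv_nonpos (convex_Ioc _ _)
    (continuousOn_logProfile k fun w hw => ⟨hw.1, by linarith [hw.2]⟩) ?_ ?_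
  · intro w hw
    rw [interior_Ioc] at hw
    exact (hasDerivAt_logProfile k hw.1 (by linarith [hw.2])).differentiableAt
      |>.differentiableWithinAt
  · intro w hw
    rw [interior_Ioc] at hw
    rw [(hasDerivAt_logProfile k hw.1 (by linarith [hw.2])).deriv]
    exact div_nonpos_of_nonpos_of_nonneg
      (mul_nonpos_of_nonneg_of_nonpos (by linarith [hw.2]) (by linarith [hw.2]))
      (mul_nonneg hw.1.le (by linarith [hw.2]))

lemma monotoneOn_logProfile {k : ℝ} (hk : IsOptimalRate k) :
    MonotoneOn (logProfile k) (Set.Icc (2 * (1 - k)) 1) := by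
  have hl := hk.upper
  norm_num at hl
  refine monotoneOn_of_deriv_nonneg (convex_Icc _ _)
    (continuousOn_logProfile k fun w hw => ⟨by linarith [hw.1], by linarith [hw.2]⟩) ?_ ?_
  · intro w hw
    rw [interior_Icc] at hw
    exact (hasDerivAt_logProfile k (by linarith [hw.1]) (by linarith [hw.2])).differentiableAt
      |>.differentiableWithinAt
  · intro w hw
    rw [interior_Icc] at hw
    rw [(hasDerivAt_logProfile k (by linarith [hw.1]) (by linarith [hw.2])).deriv]
    exact div_nonneg (mul_nonneg (by linarith [hw.2]) (by linarith [hw.1]))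
      (mul_nonneg (by linarith [hw.1]) (by linarith [hw.2]))

lemma logProfile_min_le {k : ℝ} (hk : IsOptimalRate k) {w : ℝ} (h0 : 0 < w) (h1 : w ≤ 1) :
    logProfile k (2 * (1 - k)) ≤ logProfile k w := by
  have hl := hk.lower
  have hu := hk.upper
  norm_num at hl hu
  rcases le_total w (2 * (1 - k)) with h | h
  · exact antitoneOn_logProfile hk ⟨h0, h⟩ ⟨by linarith, le_rfl⟩ h
  · exact monotoneOn_logProfile hk ⟨le_rfl, by linarith⟩ ⟨h, h1⟩ h

/-- The profile falls, then rises, on `(0, 1]`, so it is largest at an end: `w = z` means `y = 0`,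
and `w = 1` is where the integrand changes sign. -/
lemma logProfile_le_endpoint {k : ℝ} (hk : IsOptimalRate k) {z w : ℝ} (h0 : 0 < z) (hzw : z ≤ w)
    (h1 : w ≤ 1) : logProfile k w ≤ logProfile k z ∨ logProfile k w ≤ logProfile k 1 := by
  have hl := hk.lower
  have hu := hk.upper
  norm_num at hl hu
  rcases le_total w (2 * (1 - k)) with h | h
  · exact .inl (antitoneOn_logProfile hk ⟨h0, hzw.trans h⟩ ⟨h0.trans_le hzw, h⟩ hzw)
  · exact .inr (monotoneOn_logProfile hk ⟨h, h1⟩ ⟨by linarith, le_rfl⟩ h1)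

/-! ### Closed forms for the integral, `yHat` and `xHat` -/

lemma integral_abs_of_one_le {z p q : ℝ} (hz : 0 ≤ z) (hpq : p ≤ q) (h : 1 ≤ z * exp p) :
    ∫ s in p..q, |-1 + z * exp s| = z * (exp q - exp p) - (q - p) := by
  have : ∫ s in p..q, |-1 + z * exp s| = ∫ s in p..q, (-1 + z * exp s) := by
    refine intervalIntegral.integral_congr fun s hs => abs_of_nonneg ?_
    rw [Set.uIcc_of_le hpq] at hs
    nlinarith [exp_le_exp.2 hs.1]
  rw [this, intervalIntegral.integral_add (by simp)
    (Continuous.intervalIntegrable (by fun_prop) _ _),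
    intervalIntegral.integral_const_mul, integral_exp]
  simp
  ring

lemma integral_abs_of_le_one {z p q : ℝ} (hpq : p ≤ q) (hq : z * exp q ≤ 1) :
    ∫ s in p..q, |-1 + z * exp s| = (q - p) - z * (exp q - exp p) := by
  have : ∫ s in p..q, |-1 + z * exp s| = ∫ s in p..q, (1 - z * exp s) := by
    refine intervalIntegral.integral_congr fun s hs => ?_
    rw [Set.uIcc_of_le hpq] at hs
    have : z * exp s ≤ 1 := by
      rcases le_total z 0 with hz | hz
      · nlinarith [exp_pos s]
      · nlinarith [exp_le_exp.2 hs.2]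
    rw [abs_of_nonpos (by linarith)]
    ring
  rw [this, intervalIntegral.integral_sub (by simp)
    (Continuous.intervalIntegrable (by fun_prop) _ _),
    intervalIntegral.integral_const_mul, integral_exp]
  simp

lemma integral_abs_of_crossing {z y : ℝ} (hz : 0 < z) (hz1 : z ≤ 1) (h : 1 ≤ z * exp y) :
    ∫ s in (0 : ℝ)..y, |-1 + z * exp s| = -2 * log z - 2 + z + z * exp y - y := by
  have he : z * exp (-log z) = 1 := by
    rw [exp_neg, exp_log hz, mul_inv_cancel₀ hz.ne']
  have h0 : 0 ≤ -log z := by linarith [log_nonpos hz.le hz1]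
  have h1 : -log z ≤ y := by
    have := log_le_log one_pos h
    rw [log_one, log_mul hz.ne' (exp_pos y).ne', log_exp] at this
    linarith
  have hi : ∀ p q : ℝ, IntervalIntegrable (fun s => |-1 + z * exp s|) MeasureTheory.volume p q :=
    fun p q => Continuous.intervalIntegrable (by fun_prop) _ _
  rw [← intervalIntegral.integral_add_adjacent_intervals (hi 0 (-log z)) (hi _ y),
    integral_abs_of_le_one h0 he.le, integral_abs_of_one_le hz.le h1 he.ge]
  simp only [mul_sub, he, exp_zero]
  ring

lemma yHat_of_mem_Icc {y z : ℝ} (h1 : 1 ≤ z * exp y) (h3 : z * exp y ≤ 3) : yHat y z = y := by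
  have : |-2 + z * exp y| ≤ 1 := abs_le.2 ⟨by linarith, by linarith⟩
  rw [yHat, max_eq_left (log_nonpos (abs_nonneg _) this), add_zero]

lemma yHat_of_three_le {y z : ℝ} (h3 : 3 ≤ z * exp y) :
    yHat y z = y + log (z * exp y - 2) := by
  rw [yHat, abs_of_nonneg (by linarith), neg_add_eq_sub, max_eq_right (log_nonneg (by linarith))]

lemma yHat_of_le_one {y z : ℝ} (h1 : z * exp y ≤ 1) :
    yHat y z = y + log (2 - z * exp y) := by
  rw [yHat, abs_of_nonpos (by linarith), show -(-2 + z * exp y) = 2 - z * exp y by ring,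
    max_eq_right (log_nonneg (by linarith))]

lemma xHat_eq {x z : ℝ} (hx : 0 < x) (h : 2 * (2 - exp x) ≤ z) (hz : z < 2)
    (ha : exp x ≤ 3 / 2 ∨ z = 2 * (2 - exp x)) : xHat x z = x := by
  have ha1 : 1 < exp x := by simpa using hx
  have h2 : log (2 - z) ≤ log (2 * exp x - 2) := log_le_log (by linarith) (by linarith)
  rw [xHat]
  rcases ha with ha | ha
  · rw [max_eq_left (log_nonpos (by linarith) (by linarith)), min_eq_left (by linarith), add_zero]
  · rw [show 2 - z = 2 * exp x - 2 by linarith, sub_self, min_eq_right (le_max_left _ _), add_zero]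

/-! ### Tangent-line estimates -/

lemma rate_constants {k : ℝ} (hk : IsOptimalRate k) :
    k * log (2 * k) + (1 + k) * log 2 ≤ 1 + k - 0.15 ∧
      (1 + k) * log (1 + k) + k * log (2 * k) ≤ 2 * k := by
  have hl := hk.lower
  have hu := hk.upper
  have h2 : log (2 * k) ≤ 2 * k - 1 := log_le_sub_one_of_pos (by linarith)
  have h3 : log (1 + k) ≤ (1 + k) / 2 - 1 + log 2 := log_le_tangent two_pos (by linarith)
  have h4 := log_two_lt_d9
  norm_num at hl hu ⊢
  have h5 := mul_le_mul_of_nonneg_left h2 (by linarith : 0 ≤ k)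
  have h6 := mul_le_mul_of_nonneg_left h3 (by linarith : 0 ≤ 1 + k)
  constructor <;> nlinarith

/-- Both tangents are taken at `w = 2 * (1 + k)`, where each term has slope `1 / 2`. Serves with `w
= z eʸ` and with `w = 2 eˣ`. -/
lemma add_log_sub_two_le {k : ℝ} (hk : 0 < k) {w : ℝ} (hw : 2 < w) :
    (1 + k) * log w + k * log (w - 2) ≤
      w - 2 - 2 * k + (1 + k) * log (2 * (1 + k)) + k * log (2 * k) := by
  have h1 := log_le_tangent (c := 2 * (1 + k)) (t := w) (by positivity) (by linarith)
  have h2 := log_le_tangent (c := 2 * k) (t := w - 2) (by positivity) (by linarith)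
  have h1' := mul_le_mul_of_nonneg_left h1 (by linarith : 0 ≤ 1 + k)
  have h2' := mul_le_mul_of_nonneg_left h2 hk.le
  have e1 : (1 + k) * (w / (2 * (1 + k)) - 1 + log (2 * (1 + k))) =
    w / 2 - (1 + k) + (1 + k) * log (2 * (1 + k)) := by field_simp
  have e2 : k * ((w - 2) / (2 * k) - 1 + log (2 * k)) =
    (w - 2) / 2 - k + k * log (2 * k) := by field_simp
  linarith

lemma mul_log_le {k w : ℝ} (hk : 0 < 1 + k) (hw : 0 < w) :
    (1 + k) * log w ≤ w - (1 + k) + (1 + k) * log (1 + k) := by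
  have h := mul_le_mul_of_nonneg_left (log_le_tangent hk hw) hk.le
  have e : (1 + k) * (w / (1 + k) - 1 + log (1 + k)) =
    w - (1 + k) + (1 + k) * log (1 + k) := by field_simp
  linarith

lemma log_mul_exp {y z : ℝ} (hz : 0 < z) : log (z * exp y) = log z + y := by
  rw [log_mul hz.ne' (exp_pos y).ne', log_exp]

/-! ### Bounds on the `y`-gain by range of `z` -/

/-- The part of the estimate of `ŷ` common to all `z > 0` with `z eʸ ≥ 1`. -/
lemma mul_yHat_add_le {k : ℝ} (hk : IsOptimalRate k) {y z : ℝ} (hz : 0 < z)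
    (h : 1 ≤ z * exp y) :
    k * yHat y z + y - z * exp y ≤ (1 + k) * (log (1 + k) - log z) - (1 + k) ∧
      (3 ≤ z * exp y →
        k * yHat y z + y - z * exp y ≤ (1 + k) * (log (1 + k) - log z) - (1 + k) - 0.15) := by
  have hl := hk.lower
  norm_num at hl
  have hk0 : 0 < k := by linarith
  have hlog := log_mul_exp (y := y) hz
  have big : 3 ≤ z * exp y →
        k * yHat y z + y - z * exp y ≤ (1 + k) * (log (1 + k) - log z) - (1 + k) - 0.15 := by
    intro h3
    have h1 := add_log_sub_two_le hk0 (w := z * exp y) (by linarith)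
    rw [hlog, log_mul two_ne_zero (by positivity)] at h1
    rw [yHat_of_three_le h3]
    linarith [(rate_constants hk).1]
  refine ⟨?_, big⟩
  rcases le_total (z * exp y) 3 with h3 | h3
  · have h1 := mul_log_le (k := k) (by linarith) (by linarith : 0 < z * exp y)
    rw [hlog] at h1
    rw [yHat_of_mem_Icc h h3]
    linarith
  · have := big h3
    norm_num at this
    linarith

lemma yGain_of_nonpos {k : ℝ} (hk : IsOptimalRate k) {y z : ℝ} (hy : 0 ≤ y) (hz : z ≤ 0) :
    k * yHat y z - ∫ s in (0 : ℝ)..y, |-1 + z * exp s| ≤ k * log (2 - z) := by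
  have hl := hk.lower
  have hu := hk.upper
  norm_num at hl hu
  have hb : 1 ≤ exp y := one_le_exp hy
  have h1 : z * exp y ≤ 0 := mul_nonpos_of_nonpos_of_nonneg hz (by linarith)
  have ht := log_le_tangent (c := 2 - z) (t := 2 - z * exp y) (by linarith) (by linarith)
  have hf : (2 - z * exp y) / (2 - z) - 1 ≤ -z * (exp y - 1) := by
    rw [div_sub_one (by linarith), div_le_iff₀ (by linarith)]
    nlinarith [mul_nonneg (neg_nonneg.2 hz) (sub_nonneg.2 hb)]
  rw [yHat_of_le_one (by linarith), integral_abs_of_le_one hy (by linarith), exp_zero]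
  nlinarith [mul_nonneg (neg_nonneg.2 hz) (sub_nonneg.2 hb)]

lemma yGain_of_le_one {k : ℝ} (hk : IsOptimalRate k) {y z : ℝ} (hy : 0 ≤ y) (hz : 0 < z)
    (hz1 : z ≤ 1) :
    k * yHat y z - ∫ s in (0 : ℝ)..y, |-1 + z * exp s| ≤ k * log (2 - z) ∨
      k * yHat y z - ∫ s in (0 : ℝ)..y, |-1 + z * exp s| ≤
        (1 + k) * log (1 + k) + (1 - k) * log z + 1 - k - z := by
  have hl := hk.lower
  have hu := hk.upper
  norm_num at hl hu
  rcases le_total 1 (z * exp y) with h | h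
  · right
    rw [integral_abs_of_crossing hz hz1 h]
    linarith [(mul_yHat_add_le hk hz h).1]
  · have hlog := log_mul_exp (y := y) hz
    have hzw : z ≤ z * exp y := le_mul_of_one_le_right hz.le (one_le_exp hy)
    rw [integral_abs_of_le_one hy h, exp_zero, yHat_of_le_one h]
    have hp := logProfile_le_endpoint hk hz hzw h
    simp only [logProfile, hlog, log_one] at hp
    rcases hp with hp | hp
    · left
      linarith
    · right
      have h1 := mul_log_le (k := k) (w := 1) (by linarith) one_pos
      norm_num at hp h1
      linarith

lemma yGain_of_one_le {k : ℝ} (hk : IsOptimalRate k) {y z : ℝ} (hy : 0 ≤ y) (hz : 1 ≤ z) :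
    k * yHat y z - ∫ s in (0 : ℝ)..y, |-1 + z * exp s| ≤
      (1 + k) * (log (1 + k) - log z) - (1 + k) + z := by
  have h : 1 ≤ z * exp y := by nlinarith [one_le_exp hy]
  rw [integral_abs_of_one_le (by linarith) hy (by simpa using hz), exp_zero]
  linarith [(mul_yHat_add_le hk (by linarith) h).1]

lemma yGain_of_rate_le {k : ℝ} (hk : IsOptimalRate k) {y z : ℝ} (hy : 0 ≤ y) (hz : 1 + k ≤ z)
    (hz2 : z < 2) : k * yHat y z - ∫ s in (0 : ℝ)..y, |-1 + z * exp s| ≤ 0 := by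
  have hl := hk.lower
  have hu := hk.upper
  have hb : 1 + y ≤ exp y := by linarith [add_one_le_exp y]
  norm_num at hl hu
  have h : 1 ≤ z * exp y := by nlinarith
  rw [integral_abs_of_one_le (by linarith) hy (by simp; linarith), exp_zero]
  rcases le_total (z * exp y) 3 with h3 | h3
  · rw [yHat_of_mem_Icc h h3]
    nlinarith
  · have h1 := (mul_yHat_add_le hk (by linarith) h).2 h3
    have h2 := log_le_tangent (c := z) (t := 1 + k) (by linarith) (by linarith)
    have hz0 : 0 < z := by linarith
    -- Multiplied by `1 + k`, this error stays below the spare 0.15 available when `z eʸ ≥ 3`.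
    have h4 : (1 + k) / z - 1 + z / (1 + k) - 1 ≤ 0.05 := by
      rw [show (1 + k) / z - 1 + z / (1 + k) - 1 = (z - (1 + k)) ^ 2 / (z * (1 + k)) by
        field_simp; ring, div_le_iff₀ (by positivity)]
      nlinarith
    have h5 : (1 + k) * (z / (1 + k)) = z := by field_simp
    have h6 := mul_le_mul_of_nonneg_left h2 (by linarith : 0 ≤ 1 + k)
    have h7 := mul_le_mul_of_nonneg_left h4 (by linarith : 0 ≤ 1 + k)
    norm_num at h1 h7
    linarith

/-! ### The `x`-part and the upper bound -/

/-- Chord bound on `[0, 1/2]` for the convex function `t ↦ log ((1 + t) / (1 - t))`. -/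
lemma log_one_add_div_le {t : ℝ} (h0 : 0 ≤ t) (h1 : t ≤ 1 / 2) :
    log ((1 + t) / (1 - t)) ≤ 2.21 * t := by
  have h := (log_div_bounds h0 (by linarith) 4).2
  have hd : t ^ 9 / (1 - t ^ 2) ≤ t * (1 / 192) := by
    rw [div_le_iff₀ (by nlinarith)]
    have h8 : t ^ 8 ≤ (1 / 2) ^ 8 := pow_le_pow_left₀ h0 h1 8
    nlinarith
  have p2 : t ^ 2 ≤ (1 / 2) ^ 2 := pow_le_pow_left₀ h0 h1 2
  have p4 : t ^ 4 ≤ (1 / 2) ^ 4 := pow_le_pow_left₀ h0 h1 4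
  have p6 : t ^ 6 ≤ (1 / 2) ^ 6 := pow_le_pow_left₀ h0 h1 6
  have q2 := mul_le_mul_of_nonneg_left p2 h0
  have q4 := mul_le_mul_of_nonneg_left p4 h0
  have q6 := mul_le_mul_of_nonneg_left p6 h0
  norm_num [Finset.sum_range_succ] at h q2 q4 q6 hd ⊢
  ring_nf at h q2 q4 q6 hd ⊢
  linarith

lemma two_mul_one_add_rate_mul_log_le {k : ℝ} (hk : IsOptimalRate k) :
    (1 + k) * (log (1 + k) - log 2 - 1) + 2 ≤ 0.02 := by
  have hl := hk.lower
  have hu := hk.upper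
  have h1 := (log_div_bounds (x := 29 / 109) (by norm_num) (by norm_num) 4).2
  have h2 := log_le_tangent (c := 69 / 40) (t := 1 + k) (by norm_num)
    (by norm_num at hl; linarith)
  have h3 := log_two_gt_d9
  norm_num [Finset.sum_range_succ] at h1 h2 h3 hl hu ⊢
  nlinarith

/-- Since `z - (1 + k) * log z` decreases up to `1 + k`, the worst `z` is `2 * (2 - a)`. The
constraints on `z` force `a - 1 ≥ (1 - k) / 2`, which leaves room for the error 0.02. -/
lemma small_x_bound {k : ℝ} (hk : IsOptimalRate k) {a z : ℝ} (ha : 1 < a) (ha2 : a ≤ 3 / 2)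
    (hz : 2 * (2 - a) ≤ z) (hzk : z ≤ 1 + k) :
    (1 + k) * log a + ((1 + k) * (log (1 + k) - log z) - (1 + k) + z) ≤ 2 * a - 2 := by
  have hl := hk.lower
  have hu := hk.upper
  norm_num at hl hu
  have hc := two_mul_one_add_rate_mul_log_le hk
  have h1 := log_one_add_div_le (t := a - 1) (by linarith) (by linarith)
  rw [log_div (by linarith) (by linarith)] at h1
  ring_nf at h1
  have h2 : log (2 * (2 - a)) = log 2 + log (2 - a) := log_mul two_ne_zero (by linarith)
  have h3 := log_le_tangent (c := z) (t := 2 * (2 - a)) (by linarith) (by linarith)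
  have h4 : (1 + k) * (2 * (2 - a) / z - 1) ≤ 2 * (2 - a) - z := by
    rw [div_sub_one (by linarith), mul_div_assoc', div_le_iff₀ (by linarith)]
    nlinarith
  have h5 := mul_le_mul_of_nonneg_left h3 (by linarith : 0 ≤ 1 + k)
  have h6 := mul_le_mul_of_nonneg_left h1 (by linarith : 0 ≤ 1 + k)
  norm_num at hc
  nlinarith

lemma large_x_bound {k : ℝ} (hk : IsOptimalRate k) {a : ℝ} (ha : 1 < a) :
    (1 + k) * log a + k * log (2 * a - 2) ≤
      2 * a - 2 - 2 * k + (1 + k) * log (1 + k) + k * log (2 * k) := by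
  have hl := hk.lower
  norm_num at hl
  have h := add_log_sub_two_le (k := k) (by linarith) (w := 2 * a) (by linarith)
  rw [log_mul two_ne_zero (by linarith), log_mul two_ne_zero (by linarith)] at h
  linarith

lemma rate_le_profile {k : ℝ} (hk : IsOptimalRate k) {z : ℝ} (h0 : 0 < z) (h1 : z ≤ 1) :
    (1 + k) * log (1 + k) + (1 - k) * log z + 1 - k - z - k * log (2 - z) ≤
      2 * k - (1 + k) * log (1 + k) - k * log (2 * k) := by
  have h := logProfile_min_le hk h0 h1
  rw [logProfile, logProfile, show 2 - 2 * (1 - k) = 2 * k by ring] at h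
  linarith [hk.root]

theorem rate_mul_le_fullDenominator {k : ℝ} (hk : IsOptimalRate k) {x y z : ℝ} (hx : 0 < x)
    (hy : 0 ≤ y) (hz : 2 * (2 - exp x) ≤ z) (hz2 : z < 2) :
    k * (xHat x z + yHat y z) ≤ fullDenominator x y z := by
  have hl := hk.lower
  have hu := hk.upper
  norm_num at hl hu
  have ha : 1 < exp x := by simpa using hx
  rw [fullDenominator]
  have hX := large_x_bound hk ha
  have hC := (rate_constants hk).2
  rw [log_exp] at hX
  rcases le_or_gt (exp x) (3 / 2) with h | h
  · rw [xHat_eq hx hz hz2 (.inl h)]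
    rcases le_total z (1 + k) with hzk | hzk
    · have h1 := yGain_of_one_le hk hy (by linarith : 1 ≤ z)
      have h2 := small_x_bound hk ha h hz hzk
      rw [log_exp] at h2
      linarith
    · have h1 := yGain_of_rate_le hk hy hzk hz2
      nlinarith [add_one_le_exp x]
  have hlog : 0 ≤ log (2 * exp x - 2) := log_nonneg (by linarith)
  rcases le_total z 1 with hz1 | hz1
  · have hxle : xHat x z ≤ x + (log (2 * exp x - 2) - log (2 - z)) := by
      rw [xHat]
      linarith [min_le_right (max 0 (log (2 * exp x - 2))) (log (2 * exp x - 2) - log (2 - z))]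
    have hxle' := mul_le_mul_of_nonneg_left hxle (by linarith : 0 ≤ k)
    rcases le_or_gt z 0 with hz0 | hz0
    · linarith [yGain_of_nonpos hk hy hz0]
    · rcases yGain_of_le_one hk hy hz0 hz1 with hY | hY
      · linarith
      · linarith [rate_le_profile hk hz0 hz1]
  · have hxle : xHat x z ≤ x + log (2 * exp x - 2) := by
      rw [xHat, max_eq_right hlog]
      linarith [min_le_left (log (2 * exp x - 2)) (log (2 * exp x - 2) - log (2 - z))]
    have hxle' := mul_le_mul_of_nonneg_left hxle (by linarith : 0 ≤ k)
    rcases le_total z (1 + k) with hzk | hzk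
    · have h1 := yGain_of_one_le hk hy hz1
      have h2 := rate_le_profile hk one_pos le_rfl
      have h3 : 1 - z⁻¹ ≤ log z := one_sub_inv_le_log_of_pos (by linarith)
      have h4 : z - 1 ≤ (1 + k) * (1 - z⁻¹) := by
        have : (1 + k) * (1 - z⁻¹) - (z - 1) = (z - 1) * (1 + k - z) / z := by
          field_simp
        have : 0 ≤ (z - 1) * (1 + k - z) / z := by
          apply div_nonneg (mul_nonneg _ _) <;> linarith
        linarith
      have h5 := mul_le_mul_of_nonneg_left h3 (by linarith : 0 ≤ 1 + k)
      norm_num at h2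
      linarith
    · linarith [yGain_of_rate_le hk hy hzk hz2]

lemma fullDenominator_pos {x y z : ℝ} (hx : 0 < x) (hy : 0 ≤ y) : 0 < fullDenominator x y z := by
  have h : 0 ≤ ∫ s in (0 : ℝ)..y, |-1 + z * exp s| :=
    intervalIntegral.integral_nonneg hy fun _ _ => abs_nonneg _
  rw [fullDenominator]
  linarith [add_one_lt_exp hx.ne']

/-- The value `y = 0` is admitted because the special region contains `(log (3 / 2), 0)`. -/
lemma fullQuotient_le {k : ℝ} (hk : IsOptimalRate k) {x y z : ℝ} (hx : 0 < x)
    (hy : 0 ≤ y) (hz : 2 * (2 - exp x) ≤ z) (hz2 : z < 2) : fullQuotient x y z ≤ 1 / k := by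
  have hl := hk.lower
  norm_num at hl
  rw [fullQuotient, div_le_div_iff₀ (fullDenominator_pos hx hy) (by linarith)]
  linarith [rate_mul_le_fullDenominator hk hx hy hz hz2]

/-! ### The restricted family and its maximiser -/

lemma bounds_of_mem_specialRegion {x y : ℝ} (h : (x, y) ∈ specialRegion) :
    3 / 2 ≤ exp x ∧ exp x < 2 ∧ 0 < x ∧ 0 ≤ y ∧ 1 ≤ 2 * (2 - exp x) * exp y ∧
      2 * (2 - exp x) * exp y ≤ 3 := by
  obtain ⟨⟨h1, h2⟩, h3, h4⟩ := h
  simp only at h1 h2 h3 h4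
  have h1' := (log_le_iff_le_exp (by norm_num)).1 h1
  have h2' := (lt_log_iff_exp_lt (by norm_num)).1 h2
  have he : exp (-y) * exp y = 1 := by rw [← exp_add]; simp
  refine ⟨h1', h2', (log_pos (by norm_num)).trans_le h1, ?_, ?_, ?_⟩
  · have : exp (-y) ≤ 1 := by linarith
    simpa using this
  · nlinarith [exp_pos y]
  · nlinarith [exp_pos y]

lemma specialQuotient_eq_fullQuotient {x y : ℝ} (h : (x, y) ∈ specialRegion) :
    specialQuotient x y = fullQuotient x y (2 * (2 - exp x)) := by
  obtain ⟨h1, h2, hx, -, h3, h4⟩ := bounds_of_mem_specialRegion h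
  rw [specialQuotient, fullQuotient, fullDenominator, xHat_eq hx le_rfl (by linarith) (.inr rfl),
    yHat_of_mem_Icc h3 h4, integral_abs_of_crossing (by linarith) (by linarith) h3]
  congr 1
  ring

/-- The maximiser: `eˣ = 1 + k` and `z = 2(2 - eˣ) = 2(1 - k)` with `z eʸ = eˣ`. -/
lemma specialQuotient_optimal {k : ℝ} (hk : IsOptimalRate k) :
    specialQuotient (log (1 + k)) (log ((1 + k) / (2 * (1 - k)))) = 1 / k := by
  have hl := hk.lower
  have hu := hk.upper
  norm_num at hl hu
  have hroot := hk.root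
  have h1 : 0 < 1 + k := by linarith
  have h2 : 0 < 2 * (1 - k) := by linarith
  have hlog2 : log (2 * (1 - k)) ≤ 0 := log_nonpos h2.le (by linarith)
  have hlog1 : 0 ≤ log (1 + k) := log_nonneg (by linarith)
  have hlog3 : log (1 + k) ≤ k := by linarith [log_le_sub_one_of_pos h1]
  have hb : 2 * (1 - k) * ((1 + k) / (2 * (1 - k))) = 1 + k := mul_div_cancel₀ _ h2.ne'
  rw [specialQuotient, exp_log h1, exp_log (div_pos h1 h2), log_div h1.ne' h2.ne',
    show 2 - (1 + k) = 1 - k by ring, mul_add (2 * (1 - k)), hb]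
  rw [div_eq_div_iff _ (by linarith)]
  · linarith
  · apply ne_of_gt
    nlinarith

lemma optimal_mem_specialRegion {k : ℝ} (hk : IsOptimalRate k) :
    (log (1 + k), log ((1 + k) / (2 * (1 - k)))) ∈ specialRegion := by
  have hl := hk.lower
  have hu := hk.upper
  norm_num at hl hu
  have h1 : 0 < 1 + k := by linarith
  have h2 : 0 < 2 * (1 - k) := by linarith
  refine ⟨⟨log_le_log (by norm_num) (by linarith), log_lt_log h1 (by linarith)⟩, ?_, ?_⟩ <;>
    simp only [exp_neg, exp_log h1, exp_log (div_pos h1 h2), inv_div]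
  · rw [div_le_iff₀ h1]
    nlinarith
  · rw [mul_div_assoc', le_div_iff₀ h1]
    nlinarith

theorem propositionC3 :
    ∃ S : ℝ, IsLUB fullValues S ∧ IsLUB specialValues S ∧
      ∃ x y : ℝ, (x, y) ∈ specialRegion ∧
        Real.exp x = 2 * (2 - Real.exp x) * Real.exp y ∧
        specialQuotient x y = S := by
  obtain ⟨k, hk⟩ := exists_isOptimalRate
  have hl := hk.lower
  have hu := hk.upper
  norm_num at hl hu
  have h1 : 0 < 1 + k := by linarith
  have h2 : 0 < 2 * (1 - k) := by linarith
  have hmem := optimal_mem_specialRegion hk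
  have hopt := specialQuotient_optimal hk
  refine ⟨1 / k, IsGreatest.isLUB ⟨?_, ?_⟩, IsGreatest.isLUB ⟨?_, ?_⟩,
    log (1 + k), log ((1 + k) / (2 * (1 - k))), hmem, ?_, hopt⟩
  · obtain ⟨-, h4, hx, -, -, -⟩ := bounds_of_mem_specialRegion hmem
    refine ⟨_, _, 2 * (2 - exp (log (1 + k))), hx, log_pos ?_, le_rfl, ?_,
      hopt.symm.trans (specialQuotient_eq_fullQuotient hmem)⟩
    · rw [one_lt_div h2]
      linarith
    · rw [exp_log h1]
      linarith
  · rintro r ⟨x, y, z, hx, hy, hz, hz2, rfl⟩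
    exact fullQuotient_le hk hx hy.le hz hz2
  · exact ⟨_, _, hmem, hopt.symm⟩
  · rintro r ⟨x, y, h, rfl⟩
    obtain ⟨h3, -, hx, hy, -, -⟩ := bounds_of_mem_specialRegion h
    rw [specialQuotient_eq_fullQuotient h]
    exact fullQuotient_le hk hx hy le_rfl (by linarith)
  · rw [exp_log h1, exp_log (div_pos h1 h2), show 2 - (1 + k) = 1 - k by ring,
      mul_div_cancel₀ _ h2.ne']
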